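/- Let $k$ be a field of characteristic $2$ and let $V_4=\langle \sigma,\tau \mid \sigma^2=\tau^2=(\sigma\tau)^2=e\rangle$ be the Klein four-group; put $a=\sigma+e$ and $b=\tau+e$ in the group algebra $kV_4$. For $n\ge 1$ let $M_{2n+1}$ be the $(2n+1)$-dimensional $kV_4$-module with $k$-basis $u_1,\dots,u_n,v_0,\dots,v_n$ and action $$a u_i=v_{i-1},\qquad b u_i=v_i\quad(1\le i\le n),\qquad a v_j=b v_j=0\quad(0\le j\le n).$$ For a finite group $G$ and a field $k$ of characteristic $p>0$, a finitely generated $kG$-module is called a $p$-permutation module if it has a $k$-basis closed under the action of a Sylow $p$-subgroup of $G$. (For $G=V_4$ and $p=2$ this means a $k$-basis closed under the action of $V_4$, i.e. a permutation module.) A $p$-permutation resolution of a finitely generated $kG$-module $M$ is an exact complex of $kG$-modules $$\cdots\to P_2\to P_1\to P_0\to M\to 0$$ in which all $P_i$ are finitely generated $p$-permutation modules; its length is $\sup\{i\in\mathbb N : P_i\ne 0\}$, and the ($p$-)permutation dimension of $M$ is the minimal length of such a resolution. Then for every $n\ge 4$ the permutation dimension of the $kV_4$-module $M_{2n+1}$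 is equal to $2$. -/

import Mathlib

universe u v w

/-- A `k`-linear representation of `G` (equivalently a `kG`-module) is a `p`-permutation module if
it admits a `k`-basis closed under the action of a Sylow `p`-subgroup of `G`. -/
def IsPPermutation {k : Type u} [Field k] {G : Type w} [Group G] (p : ℕ)
    {V : Type v} [AddCommGroup V] [Module k V] (ρ : Representation k G V) : Prop :=
  ∃ (P : Sylow p G) (B : Set V), LinearIndependent k ((↑) : B → V) ∧
    Submodule.span k B = ⊤ ∧ ∀ g ∈ P, ∀ x ∈ B, ρ g x ∈ B

/-- A `p`-permutation resolution of the `kG`-module `(V, ρ)`: an exact complex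
`⋯ → X 2 → X 1 → X 0 → V → 0` of `kG`-modules, where all the `X i` are
finite-dimensional `p`-permutation modules. -/
structure PPermutationResolution {k : Type u} [Field k] {G : Type w} [Group G] (p : ℕ)
    {V : Type v} [AddCommGroup V] [Module k V] (ρ : Representation k G V) where
  /-- The underlying vector spaces. -/
  X : ℕ → Type u
  [addCommGroup : ∀ i, AddCommGroup (X i)]
  [module : ∀ i, Module k (X i)]
  [finite : ∀ i, Module.Finite k (X i)]
  /-- The `G`-actions. -/
  rep : ∀ i, Representation k G (X i)
  isPPermutation : ∀ i, IsPPermutation p (rep i)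
  /-- The differentials. -/
  d : ∀ i, (rep (i + 1)).IntertwiningMap (rep i)
  /-- The augmentation. -/
  ε : (rep 0).IntertwiningMap ρ
  exact_d : ∀ i, Function.Exact (d (i + 1)) (d i)
  exact_ε : Function.Exact (d 0) ε
  surjective_ε : Function.Surjective ε

/-- The length of a resolution: the supremum of the degrees of its nonzero terms. -/
noncomputable def PPermutationResolution.length {k : Type u} [Field k] {G : Type w} [Group G]
    {p : ℕ} {V : Type v} [AddCommGroup V] [Module k V] {ρ : Representation k G V}
    (R : PPermutationResolution p ρ) : ℕ∞ :=
  ⨆ (i : ℕ) (_ : Nontrivial (R.X i)), (i : ℕ∞)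

/-- The `p`-permutation dimension: the minimal length of a `p`-permutation resolution
(`⊤` if there is no resolution of finite length). -/
noncomputable def ppdim {k : Type u} [Field k] {G : Type w} [Group G] (p : ℕ)
    {V : Type v} [AddCommGroup V] [Module k V] (ρ : Representation k G V) : ℕ∞ :=
  ⨅ R : PPermutationResolution p ρ, R.length

/-- The Klein four-group `⟨σ, τ⟩`, with `σ = (ofAdd 1, 1)` and `τ = (1, ofAdd 1)`. -/
abbrev KleinV4 : Type := Multiplicative (ZMod 2) × Multiplicative (ZMod 2)

/-- In characteristic two, commuting square-zero endomorphisms `a`, `b` of `V` define a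
representation of the Klein four-group on which `σ` acts as `1 + a` and `τ` acts as `1 + b`. -/
def kleinRep {k : Type u} [Field k] [CharP k 2] {V : Type v} [AddCommGroup V] [Module k V]
    (a b : Module.End k V) (ha : a * a = 0) (hb : b * b = 0) (hab : a * b = b * a) :
    Representation k KleinV4 V where
  toFun g := (1 + a) ^ (g.1.toAdd.val) * (1 + b) ^ (g.2.toAdd.val)
  map_one' := by simp
  map_mul' := by
    have two : ∀ c : Module.End k V, c + c = 0 := fun c => by
      ext x
      have h : (2 : k) = 0 := CharTwo.two_eq_zero
      rw [LinearMap.add_apply, ← two_smul k, h, zero_smul, LinearMap.zero_apply]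
    have sq : ∀ c : Module.End k V, c * c = 0 → (1 + c) ^ 2 = 1 := fun c hc => by
      rw [sq, mul_add, add_mul, add_mul, hc, one_mul, mul_one, one_mul, add_zero, add_assoc, two,
        add_zero]
    have pow : ∀ S : Module.End k V, S ^ 2 = 1 → ∀ x y : ZMod 2,
        S ^ (x + y).val = S ^ x.val * S ^ y.val := fun S hS x y => by
      rw [← pow_add, ZMod.val_add, ← Nat.mod_add_div (x.val + y.val) 2, pow_add, pow_mul, hS,
        one_pow, mul_one, Nat.mod_add_div]
    have hcomm : Commute (1 + a) (1 + b) :=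
      ((Commute.one_left _).add_left ((Commute.one_right _).add_right hab))
    rintro ⟨x, y⟩ ⟨x', y'⟩
    simp only [Prod.mk_mul_mk, toAdd_mul]
    rw [pow _ (sq a ha), pow _ (sq b hb), mul_assoc, mul_assoc]
    congr 1
    rw [← mul_assoc, ← mul_assoc, (hcomm.pow_pow _ _).eq]

/-- The `k`-vector space with basis `u₁, …, uₙ, v₀, …, vₙ`: the vector `u_{i+1}` is indexed by
`Sum.inl i` with `i : Fin n`, and `v_j` is indexed by `Sum.inr j` with `j : Fin (n + 1)`. -/
abbrev MSpace (k : Type u) [Field k] (n : ℕ) : Type u := (Fin n ⊕ Fin (n + 1)) →₀ k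

/-- The operator `a` on the `M`-shaped module: `a u_{i+1} = v_i` and `a v_j = 0`. -/
noncomputable def MSpace.a (k : Type u) [Field k] (n : ℕ) : Module.End k (MSpace k n) :=
  Finsupp.linearCombination k
    (Sum.elim (fun i : Fin n => Finsupp.single (Sum.inr i.castSucc) 1) (fun _ => 0))

/-- The operator `b` on the `M`-shaped module: `b u_{i+1} = v_{i+1}` and `b v_j = 0`. -/
noncomputable def MSpace.b (k : Type u) [Field k] (n : ℕ) : Module.End k (MSpace k n) :=
  Finsupp.linearCombination k
    (Sum.elim (fun i : Fin n => Finsupp.single (Sum.inr i.succ) 1) (fun _ => 0))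

/-- The `(2n+1)`-dimensional `M`-shaped module `M_{2n+1}` of the Klein four-group. -/
noncomputable def MRep (k : Type u) [Field k] [CharP k 2] (n : ℕ) :
    Representation k KleinV4 (MSpace k n) :=
  kleinRep (MSpace.a k n) (MSpace.b k n)
    (by ext i : 2; rcases i with i | i <;> simp [MSpace.a])
    (by ext i : 2; rcases i with i | i <;> simp [MSpace.b])
    (by ext i : 2; rcases i with i | i <;> simp [MSpace.a, MSpace.b])

/-!
# The permutation dimension of `M_{2n+1}` is two for `n ≥ 4`

Write `a = σ - 1`, `b = τ - 1`, so that `στ - 1 = a + b + ab`, and `M = M_{2n+1}`.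

*Upper bound.* Cover `M` by `n` free modules, one for each `uᵢ`, together with `n + 1` trivial
modules, one for each `vⱼ`. As the trivial modules already cover the radical of `M`, the kernel is
`rad(kV₄)ⁿ`. The module `rad(kV₄)` is generated by `a` and `b` and is the quotient of
`k[V₄/⟨σ⟩] ⊕ k[V₄/⟨τ⟩]` by a copy of `k`. This gives `ppdim_le_two_of_radical_sq_eq_zero`.

*Lower bound.* Let `0 → P₁ → P₀ → M → 0` be exact with `P₀` and `P₁` permutation modules. Compare
ranks of operators on the three terms.

* A permutation module satisfies `rk a + rk b + rk (a + b + ab) = rk (a + ωb) + 2 rk (ab)`, where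
  `a + ωb` acts after extension of scalars to `k[ω]`, `ω² = ω + 1`, and all ranks are dimensions
  over `k` (`RankIdentity`). Indeed all ranks are additive, and the relation is
  checked according to the stabilizers of the basis vectors
  (`IsPPermutation.nonempty_kleinDecomposition`): if a stabilizer contains `σ`, `τ` or `στ`, then
  one of the three operators vanishes; on the free part all operators are exact.
* The three ranks on the left grow from `P₁` to `P₀` by at most `n + 1`, the dimension of the
  kernels on `M` (`finrank_range_le_of_exact`).
* The rank of `a + ωb` grows by at least its rank on `M`, which is `2n`: the kernel of `a + ωb`
  on `M ⊗ k[ω]` is the socle, of dimension `2(n + 1)` over `k`.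
* The rank of `ab` grows by at least `n`. Indeed a vector of `P₀` killed by `ab` goes to the socle
  of `M` (`KleinDecomposition.map_mem_of_mul_apply_eq_zero`), which has codimension `n`.

Hence `2n + 2n ≤ 3(n + 1)`, that is, `n ≤ 3`.
-/

/-! ### Ranks of the operators on stable subspaces -/

section RankIdentity

open Module Submodule

variable {k : Type u} [Field k] {V : Type v} [AddCommGroup V] [Module k V]

/-- The operator `a ⊗ 1 + b ⊗ ω` on `V ⊗ k[ω] = V × V`, where `ω² = ω + 1`. In characteristic two
it is the cyclic shifted subgroup operator attached to an `𝔽₄`-point of the projective line that is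
not an `𝔽₂`-point; the model `V × V` makes it available over every field, including `𝔽₂`. -/
def quadPencil (a b : End k V) : End k (V × V) :=
  (a.coprod b).prod (b.coprod (a + b))

@[simp]
lemma quadPencil_apply (a b : End k V) (z : V × V) :
    quadPencil a b z = (a z.1 + b z.2, b z.1 + (a z.2 + b z.2)) := rfl

/-- The relation `rk a + rk b + rk (a + b + ab) = rk (a ⊗ 1 + b ⊗ ω) + 2 rk (ab)` between ranks
on `S`. For `a = σ - 1` and `b = τ - 1`, the operator `a + b + ab` is `στ - 1`. -/
def RankIdentity (a b : End k V) (S : Submodule k V) : Prop :=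
  finrank k (S.map a) + finrank k (S.map b) + finrank k (S.map (a + b + a * b)) =
    finrank k ((S.prod S).map (quadPencil a b)) + 2 * finrank k (S.map (a * b))

lemma finrank_map_add_finrank_inf_ker {W : Type*} [AddCommGroup W] [Module k W]
    (S : Submodule k V) [FiniteDimensional k S] (x : V →ₗ[k] W) :
    finrank k (S.map x) + finrank k ↥(S ⊓ LinearMap.ker x) = finrank k S := by
  have h := LinearMap.finrank_range_add_finrank_ker (x.domRestrict S)
  rw [LinearMap.range_domRestrict] at h
  rw [← h, ← Submodule.map_comap_subtype, Submodule.finrank_map_subtype_eq]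
  rfl

lemma finrank_map_sup_of_disjoint [FiniteDimensional k V] {x : End k V} {S S' : Submodule k V}
    (h : Disjoint S S') (hS : S.map x ≤ S) (hS' : S'.map x ≤ S') :
    finrank k ((S ⊔ S').map x) = finrank k (S.map x) + finrank k (S'.map x) := by
  rw [Submodule.map_sup, ← Submodule.finrank_sup_add_finrank_inf_eq,
    (h.mono hS hS').eq_bot, finrank_bot, add_zero]

lemma map_mul_le_of_map_le {a b : End k V} {S : Submodule k V} (ha : S.map a ≤ S)
    (hb : S.map b ≤ S) : S.map (a * b) ≤ S := by
  rw [Module.End.mul_eq_comp, Submodule.map_comp]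
  exact (Submodule.map_mono hb).trans ha

lemma map_add_le_of_map_le {a b : End k V} {S : Submodule k V} (ha : S.map a ≤ S)
    (hb : S.map b ≤ S) : S.map (a + b) ≤ S :=
  (Submodule.map_add_le S a b).trans (sup_le ha hb)

lemma map_quadPencil_le {a b : End k V} {S : Submodule k V} (ha : S.map a ≤ S)
    (hb : S.map b ≤ S) : (S.prod S).map (quadPencil a b) ≤ S.prod S := by
  rw [Submodule.map_le_iff_le_comap] at ha hb ⊢
  intro z hz
  exact ⟨add_mem (ha hz.1) (hb hz.2), add_mem (hb hz.1) (add_mem (ha hz.2) (hb hz.2))⟩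

lemma RankIdentity.sup [FiniteDimensional k V] {a b : End k V} {S S' : Submodule k V}
    (h : RankIdentity a b S) (h' : RankIdentity a b S') (hd : Disjoint S S')
    (ha : S.map a ≤ S) (hb : S.map b ≤ S) (ha' : S'.map a ≤ S') (hb' : S'.map b ≤ S') :
    RankIdentity a b (S ⊔ S') := by
  have hab := map_mul_le_of_map_le ha hb
  have hab' := map_mul_le_of_map_le ha' hb'
  have hp : Disjoint (S.prod S) (S'.prod S') := by
    rw [disjoint_iff, Submodule.prod_inf_prod, hd.eq_bot, Submodule.prod_bot]
  unfold RankIdentity at *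
  rw [← Submodule.prod_sup_prod, finrank_map_sup_of_disjoint hd ha ha',
    finrank_map_sup_of_disjoint hd hb hb', finrank_map_sup_of_disjoint hd hab hab',
    finrank_map_sup_of_disjoint hd (map_add_le_of_map_le (map_add_le_of_map_le ha hb) hab)
      (map_add_le_of_map_le (map_add_le_of_map_le ha' hb') hab'),
    finrank_map_sup_of_disjoint hp (map_quadPencil_le ha hb) (map_quadPencil_le ha' hb')]
  omega

lemma finrank_prod_submodule [FiniteDimensional k V] (S : Submodule k V) :
    finrank k (S.prod S) = 2 * finrank k S := by
  have h : S.prod S = LinearMap.range (S.subtype.prodMap S.subtype) := by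
    rw [LinearMap.range_prodMap, Submodule.range_subtype]
  rw [h, LinearMap.finrank_range_of_inj (S.subtype_injective.prodMap S.subtype_injective),
    Module.finrank_prod, two_mul]

lemma map_congr_of_mem {W : Type*} [AddCommGroup W] [Module k W] {x y : V →ₗ[k] W}
    {S : Submodule k V} (h : ∀ z ∈ S, x z = y z) : S.map x = S.map y :=
  SetLike.coe_injective (Set.image_congr h)

lemma map_eq_bot_of_mem {W : Type*} [AddCommGroup W] [Module k W] {x : V →ₗ[k] W}
    {S : Submodule k V} (h : ∀ z ∈ S, x z = 0) : S.map x = ⊥ :=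
  (Submodule.map_le_iff_le_comap.2 fun z hz => h z hz : S.map x ≤ ⊥).antisymm bot_le

/-- Where `a` vanishes, `στ - 1` acts as `b` and the pencil as `b ⊗ ω`. -/
lemma rankIdentity_of_left_eq_zero [FiniteDimensional k V] {a b : End k V} {S : Submodule k V}
    (hab : a * b = b * a) (ha : ∀ z ∈ S, a z = 0) : RankIdentity a b S := by
  have hab0 : ∀ z ∈ S, (a * b) z = 0 := fun z hz => by
    rw [hab, Module.End.mul_apply, ha z hz, map_zero]
  have hq : (S.prod S).map (quadPencil a b) = (S.map b).prod (S.map b) := by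
    apply le_antisymm
    · rintro _ ⟨⟨x, y⟩, ⟨hx, hy⟩, rfl⟩
      refine ⟨⟨y, hy, ?_⟩, ⟨x + y, add_mem hx hy, ?_⟩⟩
      · simp [ha x hx]
      · simp [ha y hy]
    · rintro ⟨_, _⟩ ⟨⟨x, hx, rfl⟩, ⟨y, hy, rfl⟩⟩
      refine ⟨(y - x, x), ⟨sub_mem hy hx, hx⟩, ?_⟩
      ext <;> simp [ha x hx, ha y hy]
  rw [RankIdentity, hq, finrank_prod_submodule, map_eq_bot_of_mem ha, map_eq_bot_of_mem hab0,
    map_congr_of_mem (x := a + b + a * b) (y := b) (fun z hz => by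
      rw [LinearMap.add_apply, hab0 z hz, LinearMap.add_apply, ha z hz, zero_add, add_zero]),
    finrank_bot]
  omega

/-- Where `b` vanishes, `στ - 1` acts as `a` and the pencil as `a ⊗ 1`. -/
lemma rankIdentity_of_right_eq_zero [FiniteDimensional k V] {a b : End k V} {S : Submodule k V}
    (hb : ∀ z ∈ S, b z = 0) : RankIdentity a b S := by
  have hab0 : ∀ z ∈ S, (a * b) z = 0 := fun z hz => by
    rw [Module.End.mul_apply, hb z hz, map_zero]
  have hq : (S.prod S).map (quadPencil a b) = (S.map a).prod (S.map a) := by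
    apply le_antisymm
    · rintro _ ⟨⟨x, y⟩, ⟨hx, hy⟩, rfl⟩
      refine ⟨⟨x, hx, ?_⟩, ⟨y, hy, ?_⟩⟩
      · simp [hb y hy]
      · simp [hb y hy, hb x hx]
    · rintro ⟨_, _⟩ ⟨⟨x, hx, rfl⟩, ⟨y, hy, rfl⟩⟩
      refine ⟨(x, y), ⟨hx, hy⟩, ?_⟩
      ext <;> simp [hb x hx, hb y hy]
  rw [RankIdentity, hq, finrank_prod_submodule, map_eq_bot_of_mem hb, map_eq_bot_of_mem hab0,
    map_congr_of_mem (x := a + b + a * b) (y := a) (fun z hz => by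
      rw [LinearMap.add_apply, hab0 z hz, LinearMap.add_apply, hb z hz, add_zero, add_zero]),
    finrank_bot]
  omega

lemma mul_apply_eq_zero_of_add_add_mul_apply_eq_zero {a b : End k V} (ha : a * a = 0) {z : V}
    (hz : (a + b + a * b) z = 0) : (a * b) z = 0 := by
  have h : (a * (a + b + a * b)) z = 0 := by rw [Module.End.mul_apply, hz, map_zero]
  rwa [mul_add, mul_add, ha, ← mul_assoc, ha, zero_mul, zero_add, add_zero] at h

/-- Where `στ - 1` vanishes, `b` acts as `-a` and the pencil as `a ⊗ (1 - ω)`. -/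
lemma rankIdentity_of_add_add_mul_eq_zero [FiniteDimensional k V] {a b : End k V}
    {S : Submodule k V} (ha : a * a = 0) (hc : ∀ z ∈ S, (a + b + a * b) z = 0) :
    RankIdentity a b S := by
  have hab0 : ∀ z ∈ S, (a * b) z = 0 := fun z hz =>
    mul_apply_eq_zero_of_add_add_mul_apply_eq_zero ha (hc z hz)
  have hb : ∀ z ∈ S, b z = -a z := fun z hz => by
    have h := hc z hz
    rw [LinearMap.add_apply, hab0 z hz, add_zero, LinearMap.add_apply] at h
    exact (neg_eq_of_add_eq_zero_right h).symm
  have hq : (S.prod S).map (quadPencil a b) = (S.map a).prod (S.map a) := by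
    apply le_antisymm
    · rintro _ ⟨⟨x, y⟩, ⟨hx, hy⟩, rfl⟩
      refine ⟨⟨x - y, sub_mem hx hy, ?_⟩, ⟨-x, neg_mem hx, ?_⟩⟩
      · simp [hb y hy, sub_eq_add_neg]
      · simp [hb y hy, hb x hx]
    · rintro ⟨_, _⟩ ⟨⟨x, hx, rfl⟩, ⟨y, hy, rfl⟩⟩
      refine ⟨(-y, -y - x), ⟨neg_mem hy, sub_mem (neg_mem hy) hx⟩, ?_⟩
      ext <;> simp [hb x hx, hb y hy]
  have hba : S.map b = S.map a := by
    rw [map_congr_of_mem (x := b) (y := -a) (fun z hz => by simp [hb z hz]), Submodule.map_neg]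
  rw [RankIdentity, hq, finrank_prod_submodule, hba, map_eq_bot_of_mem hab0,
    map_eq_bot_of_mem hc, finrank_bot]
  omega

/-- A square-zero operator `x` on `S` with a contracting homotopy `h` is exact on `S`, so its rank is
half the dimension. -/
lemma two_mul_finrank_map_of_homotopy [FiniteDimensional k V] {x h : End k V} {S : Submodule k V}
    (hx : ∀ z ∈ S, x (x z) = 0) (hxS : ∀ z ∈ S, x z ∈ S) (hhS : ∀ z ∈ S, h z ∈ S)
    (hom : ∀ z ∈ S, h (x z) + x (h z) = z) : 2 * finrank k (S.map x) = finrank k S := by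
  have hker : S ⊓ LinearMap.ker x = S.map x := by
    apply le_antisymm
    · rintro z ⟨hz, hxz⟩
      refine ⟨h z, hhS z hz, ?_⟩
      have := hom z hz
      rwa [LinearMap.mem_ker.1 hxz, map_zero, zero_add] at this
    · rintro _ ⟨z, hz, rfl⟩
      exact ⟨hxS z hz, hx z hz⟩
  have := finrank_map_add_finrank_inf_ker S x
  rw [hker] at this
  omega

lemma add_self_eq_zero_of_charTwo [CharP k 2] (z : V) : z + z = 0 := by
  rw [← two_smul k, CharTwo.two_eq_zero, zero_smul]

lemma add_add_mul_sq_eq_zero [CharP k 2] {a b : End k V} (ha : a * a = 0) (hb : b * b = 0)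
    (hab : a * b = b * a) : (a + b + a * b) * (a + b + a * b) = 0 := by
  have two : a * b + a * b = 0 := by
    ext z
    exact add_self_eq_zero_of_charTwo (k := k) ((a * b) z)
  have h1 : b * (a * b) = 0 := by rw [hab, ← mul_assoc, hb, zero_mul]
  have h2 : a * b * a = 0 := by rw [mul_assoc, ← hab, ← mul_assoc, ha, zero_mul]
  have h3 : a * b * b = 0 := by rw [mul_assoc, hb, mul_zero]
  have h4 : a * (a * b) = 0 := by rw [← mul_assoc, ha, zero_mul]
  simp only [add_mul, mul_add, ha, hb, h1, h2, h3, h4, ← hab, zero_add, add_zero]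
  rw [← mul_assoc, h2, zero_mul, add_zero, two]

/-- A submodule on which `a` and `b` both have contracting homotopies, each commuting with the other
operator, satisfies the rank relation: all the operators involved are
exact on it. -/
lemma rankIdentity_of_homotopies [FiniteDimensional k V] [CharP k 2] {a b h h' : End k V}
    {S : Submodule k V} (ha : a * a = 0) (hb : b * b = 0) (hab : a * b = b * a)
    (haS : ∀ z ∈ S, a z ∈ S) (hbS : ∀ z ∈ S, b z ∈ S)
    (hS : ∀ z ∈ S, h z ∈ S) (hS' : ∀ z ∈ S, h' z ∈ S)
    (hom : ∀ z ∈ S, h (a z) + a (h z) = z) (hom' : ∀ z ∈ S, h' (b z) + b (h' z) = z)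
    (hhb : ∀ z, h (b z) = b (h z)) (hha : ∀ z, h' (a z) = a (h' z)) :
    RankIdentity a b S := by
  have ha0 : ∀ z, a (a z) = 0 := fun z => by rw [← Module.End.mul_apply, ha]; rfl
  have hb0 : ∀ z, b (b z) = 0 := fun z => by rw [← Module.End.mul_apply, hb]; rfl
  have hba : ∀ z, b (a z) = a (b z) := fun z => by
    rw [← Module.End.mul_apply, ← hab]; rfl
  have two : ∀ w : V, w + w = 0 := add_self_eq_zero_of_charTwo (k := k)
  have e1 := two_mul_finrank_map_of_homotopy (fun z _ => ha0 z) haS hS hom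
  have e2 := two_mul_finrank_map_of_homotopy (fun z _ => hb0 z) hbS hS' hom'
  have e3 : 2 * finrank k (S.map (a + b + a * b)) = finrank k S := by
    -- `b` commutes with the homotopy of `a`, so `τ` times that homotopy serves for `στ - 1`.
    refine two_mul_finrank_map_of_homotopy (h := h + b * h) (fun z _ => ?_) (fun z hz => ?_)
      (fun z hz => ?_) (fun z hz => ?_)
    · rw [← Module.End.mul_apply, add_add_mul_sq_eq_zero ha hb hab, LinearMap.zero_apply]
    · exact add_mem (add_mem (haS z hz) (hbS z hz)) (haS _ (hbS z hz))
    · exact add_mem (hS z hz) (hbS _ (hS z hz))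
    · have h1 : h (a z) = z - a (h z) := eq_sub_of_add_eq (hom z hz)
      have h2 : h (a (b z)) = b z - a (b (h z)) := by
        rw [← hhb]; exact eq_sub_of_add_eq (hom (b z) (hbS z hz))
      simp only [LinearMap.add_apply, Module.End.mul_apply, map_add, map_sub, h1, h2, hhb,
        hb0, hba, map_zero]
      linear_combination (norm := module) two (b (h z)) + two (b z)
  have e4 : 2 * finrank k ((S.prod S).map (quadPencil a b)) = finrank k (S.prod S) := by
    refine two_mul_finrank_map_of_homotopy (h := h.prodMap h) (fun z _ => ?_) (fun z hz => ?_)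
      (fun z hz => ?_) (fun z hz => ?_)
    · ext
      · simp only [quadPencil_apply, map_add, ha0, hb0, hba, Prod.fst_zero]
        linear_combination (norm := module) two (a (b z.2))
      · simp only [quadPencil_apply, map_add, ha0, hb0, hba, Prod.snd_zero]
        linear_combination (norm := module) two (a (b z.1)) + two (a (b z.2))
    · exact ⟨add_mem (haS _ hz.1) (hbS _ hz.2),
        add_mem (hbS _ hz.1) (add_mem (haS _ hz.2) (hbS _ hz.2))⟩
    · exact ⟨hS _ hz.1, hS _ hz.2⟩
    · have h1 := hom _ hz.1
      have h2 := hom _ hz.2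
      ext
      · simp only [quadPencil_apply, LinearMap.prodMap_apply, Prod.fst_add, map_add, hhb]
        linear_combination (norm := module) h1 + two (b (h z.2))
      · simp only [quadPencil_apply, LinearMap.prodMap_apply, Prod.snd_add, map_add, hhb]
        linear_combination (norm := module) h2 + two (b (h z.1)) + two (b (h z.2))
  have e5 : 2 * finrank k (S.map (a * b)) = finrank k (S.map a) := by
    rw [hab, Module.End.mul_eq_comp, Submodule.map_comp]
    refine two_mul_finrank_map_of_homotopy (h := h') (fun z _ => hb0 z) ?_ ?_ ?_
    · rintro _ ⟨z, hz, rfl⟩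
      exact ⟨b z, hbS z hz, (hba z).symm⟩
    · rintro _ ⟨z, hz, rfl⟩
      exact ⟨h' z, hS' z hz, (hha z).symm⟩
    · rintro _ ⟨z, hz, rfl⟩
      exact hom' _ (haS z hz)
  rw [finrank_prod_submodule] at e4
  unfold RankIdentity
  omega

end RankIdentity

/-! ### Permutation modules of the Klein four-group -/

namespace KleinV4

/-- The first generator of the Klein four-group. -/
abbrev σ : KleinV4 := (Multiplicative.ofAdd 1, 1)

/-- The second generator of the Klein four-group. -/
abbrev τ : KleinV4 := (1, Multiplicative.ofAdd 1)

lemma mul_self (g : KleinV4) : g * g = 1 := by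
  revert g; decide

lemma eq_one_or (g : KleinV4) : g = 1 ∨ g = σ ∨ g = τ ∨ g = σ * τ := by
  revert g; decide

lemma sum_eq {A : Type*} [AddCommMonoid A] (f : KleinV4 → A) :
    ∑ g, f g = f 1 + f σ + f τ + f (σ * τ) := by
  have h : (Finset.univ : Finset KleinV4) = {1, σ, τ, σ * τ} := by decide
  rw [h, Finset.sum_insert (by decide), Finset.sum_insert (by decide),
    Finset.sum_insert (by decide), Finset.sum_singleton]
  simp only [add_assoc]

lemma sylow_eq_top (P : Sylow 2 KleinV4) : (P : Subgroup KleinV4) = ⊤ := by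
  refine (P.is_maximal' (Q := ⊤) (IsPGroup.of_card (n := 2) ?_) le_top).symm
  simp [Nat.card_eq_fintype_card, ZMod.card]

end KleinV4

open KleinV4

section Decomposition

open Module Submodule

variable {k : Type u} [Field k] {V : Type v} [AddCommGroup V] [Module k V]

/-- A decomposition of `V`, stable under two operators `a` and `b`, into parts where `a`, `b` and
`a + b + ab` vanish respectively, and a part on which `a` and `b` have contracting homotopies
`h` and `h'`, each commuting with the other operator. For a permutation module of the
Klein four-group, the first three parts are spanned by the basis vectors fixed by `σ`, `τ` and `στ`
respectively (a vector fixed by the whole group is put into the first), and the fourth is free. -/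
structure KleinDecomposition (a b : End k V) where
  /-- The part annihilated by `a`. -/
  kerLeft : Submodule k V
  /-- The part annihilated by `b`. -/
  kerRight : Submodule k V
  /-- The part annihilated by `a + b + ab`. -/
  kerDiag : Submodule k V
  /-- The free part. -/
  free : Submodule k V
  /-- The homotopy for `a`. -/
  h : End k V
  /-- The homotopy for `b`. -/
  h' : End k V
  left_mem : ∀ S ∈ [kerLeft, kerRight, kerDiag, free], ∀ z ∈ S, a z ∈ S
  right_mem : ∀ S ∈ [kerLeft, kerRight, kerDiag, free], ∀ z ∈ S, b z ∈ S
  sup_eq_top : kerLeft ⊔ kerRight ⊔ kerDiag ⊔ free = ⊤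
  disjoint_right : Disjoint kerLeft kerRight
  disjoint_diag : Disjoint (kerLeft ⊔ kerRight) kerDiag
  disjoint_free : Disjoint (kerLeft ⊔ kerRight ⊔ kerDiag) free
  left_eq_zero : ∀ z ∈ kerLeft, a z = 0
  right_eq_zero : ∀ z ∈ kerRight, b z = 0
  diag_eq_zero : ∀ z ∈ kerDiag, (a + b + a * b) z = 0
  h_mem : ∀ z ∈ free, h z ∈ free
  h'_mem : ∀ z ∈ free, h' z ∈ free
  homotopy : ∀ z ∈ free, h (a z) + a (h z) = z
  homotopy' : ∀ z ∈ free, h' (b z) + b (h' z) = z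
  h_right : ∀ z, h (b z) = b (h z)
  h'_left : ∀ z, h' (a z) = a (h' z)

namespace KleinDecomposition

variable {a b : End k V}

lemma rankIdentity [FiniteDimensional k V] [CharP k 2] (D : KleinDecomposition a b)
    (ha : a * a = 0) (hb : b * b = 0) (hab : a * b = b * a) : RankIdentity a b ⊤ := by
  have hl := D.left_mem
  have hr := D.right_mem
  simp only [List.forall_mem_cons, List.not_mem_nil, false_imp_iff, implies_true, and_true]
    at hl hr
  obtain ⟨l1, l2, l3, l4⟩ := hl
  obtain ⟨r1, r2, r3, r4⟩ := hr
  have m {x : End k V} {S : Submodule k V} (h : ∀ z ∈ S, x z ∈ S) : S.map x ≤ S :=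
    Submodule.map_le_iff_le_comap.2 h
  have m2 {x : End k V} {S S' : Submodule k V} (h : S.map x ≤ S) (h' : S'.map x ≤ S') :
      (S ⊔ S').map x ≤ S ⊔ S' := by
    rw [Submodule.map_sup]; exact sup_le_sup h h'
  have i1 := rankIdentity_of_left_eq_zero hab D.left_eq_zero
  have i2 := rankIdentity_of_right_eq_zero (a := a) D.right_eq_zero
  have i3 := rankIdentity_of_add_add_mul_eq_zero ha D.diag_eq_zero
  have i4 := rankIdentity_of_homotopies ha hb hab l4 r4 D.h_mem D.h'_mem D.homotopy D.homotopy'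
    D.h_right D.h'_left
  rw [← D.sup_eq_top]
  exact ((i1.sup i2 D.disjoint_right (m l1) (m r1) (m l2) (m r2)).sup i3 D.disjoint_diag
    (m2 (m l1) (m l2)) (m2 (m r1) (m r2)) (m l3) (m r3)).sup i4 D.disjoint_free
    (m2 (m2 (m l1) (m l2)) (m l3)) (m2 (m2 (m r1) (m r2)) (m r3)) (m l4) (m r4)

/-- If `ab` kills `z`, then every map to a module in which the kernels of `a`, `b` and `a + b + ab`
lie in a submodule `N` containing the images of `a` and `b` sends `z` into `N`. On the free part this
is exactness of the Koszul complex of `a` and `b`. -/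
lemma map_mem_of_mul_apply_eq_zero (D : KleinDecomposition a b) (ha : a * a = 0)
    (hab : a * b = b * a) {W : Type*} [AddCommGroup W] [Module k W] {a' b' : End k W}
    {N : Submodule k W} (hNa : ∀ w, a' w ∈ N) (hNb : ∀ w, b' w ∈ N)
    (hka : ∀ w, a' w = 0 → w ∈ N) (hkb : ∀ w, b' w = 0 → w ∈ N)
    (hkc : ∀ w, (a' + b' + a' * b') w = 0 → w ∈ N)
    {f : V →ₗ[k] W} (hfa : ∀ z, f (a z) = a' (f z)) (hfb : ∀ z, f (b z) = b' (f z))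
    {z : V} (hz : (a * b) z = 0) : f z ∈ N := by
  have hz' : z ∈ D.kerLeft ⊔ D.kerRight ⊔ D.kerDiag ⊔ D.free := D.sup_eq_top ▸ Submodule.mem_top
  obtain ⟨y, hy, z4, h4, rfl⟩ := Submodule.mem_sup.1 hz'
  obtain ⟨y', hy', z3, h3, rfl⟩ := Submodule.mem_sup.1 hy
  obtain ⟨z1, h1, z2, h2, rfl⟩ := Submodule.mem_sup.1 hy'
  have k1 := D.left_eq_zero z1 h1
  have k2 := D.right_eq_zero z2 h2
  have k3 := D.diag_eq_zero z3 h3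
  have n1 : (a * b) z1 = 0 := by rw [hab, Module.End.mul_apply, k1, map_zero]
  have n2 : (a * b) z2 = 0 := by rw [Module.End.mul_apply, k2, map_zero]
  have n3 : (a * b) z3 = 0 := mul_apply_eq_zero_of_add_add_mul_apply_eq_zero ha k3
  rw [map_add, map_add, map_add, n1, n2, n3, zero_add, zero_add, zero_add,
    Module.End.mul_apply] at hz
  have hbz : b z4 ∈ D.free := D.right_mem D.free (by simp) z4 h4
  -- `b z₄` is a cycle for `a`, hence a boundary; `h' b + b h' = 1` then expresses `z₄`.
  have hbz' : a (D.h (b z4)) = b z4 := by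
    have := D.homotopy _ hbz
    rwa [hz, map_zero, zero_add] at this
  have e4 : a (D.h' (D.h (b z4))) + b (D.h' z4) = z4 := by
    rw [← D.h'_left, hbz']
    exact D.homotopy' z4 h4
  have f4 : f z4 ∈ N := by
    rw [← e4, map_add, hfa, hfb]
    exact add_mem (hNa _) (hNb _)
  have f1 : f z1 ∈ N := hka _ (by rw [← hfa, k1, map_zero])
  have f2 : f z2 ∈ N := hkb _ (by rw [← hfb, k2, map_zero])
  have f3 : f z3 ∈ N := hkc _ (by
    have := congrArg f k3
    simpa [hfa, hfb] using this)
  rw [map_add, map_add, map_add]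
  exact add_mem (add_mem (add_mem f1 f2) f3) f4

end KleinDecomposition

/-- Every permutation module of the Klein four-group has a Klein decomposition: group the basis
vectors by their stabilizers. On the span of the basis vectors with trivial stabilizer, let `e`
be the projection onto a transversal of the orbits; then `e + τeτ + σeσ + στeστ = 1`, so that
`σ(e + τeτ)` and `τ(e + σeσ)` are the homotopies sought. -/
theorem IsPPermutation.nonempty_kleinDecomposition [CharP k 2] {ρ : Representation k KleinV4 V}
    (hρ : IsPPermutation 2 ρ) : Nonempty (KleinDecomposition (ρ σ - 1) (ρ τ - 1)) := by
  classical
  obtain ⟨P, B, hli, hsp, hB'⟩ := hρ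
  have hB : ∀ g, ∀ x ∈ B, ρ g x ∈ B := fun g => hB' g (by
    rw [← SetLike.mem_coe, ← Sylow.coe_coe, sylow_eq_top]; trivial)
  have mul (g h : KleinV4) (z : V) : ρ g (ρ h z) = ρ (g * h) z := by
    rw [map_mul, Module.End.mul_apply]
  have one (z : V) : ρ 1 z = z := by rw [map_one, Module.End.one_apply]
  have inj (g : KleinV4) {x y : V} (h : ρ g x = ρ g y) : x = y := by
    have := congrArg (ρ g⁻¹) h
    rwa [mul, mul, inv_mul_cancel, one, one] at this
  have fix (g h : KleinV4) (x : V) : ρ h (ρ g x) = ρ g x ↔ ρ h x = x := by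
    rw [mul, mul_comm, ← mul]
    exact ⟨fun h => inj g h, fun h => by rw [h]⟩
  -- the basis vectors, sorted by stabilizer; vectors fixed by the whole group go to `B1`
  let B1 : Set V := {x ∈ B | ρ σ x = x}
  let B2 : Set V := {x ∈ B | ρ τ x = x ∧ ρ σ x ≠ x}
  let B3 : Set V := {x ∈ B | ρ (σ * τ) x = x ∧ ρ σ x ≠ x ∧ ρ τ x ≠ x}
  let B4 : Set V := {x ∈ B | ρ (σ * τ) x ≠ x ∧ ρ σ x ≠ x ∧ ρ τ x ≠ x}
  have stable : ∀ D ∈ [B1, B2, B3, B4], ∀ g, ∀ x ∈ D, ρ g x ∈ D := by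
    simp only [List.forall_mem_cons, List.not_mem_nil, false_imp_iff, implies_true, and_true]
    refine ⟨?_, ?_, ?_, ?_⟩ <;> rintro g x ⟨hx, hx'⟩ <;> refine ⟨hB g x hx, ?_⟩ <;>
      simpa only [fix, ne_eq] using hx'
  have stable' : ∀ S ∈ [span k B1, span k B2, span k B3, span k B4], ∀ g, ∀ z ∈ S, ρ g z ∈ S := by
    intro S hS g
    change S ≤ S.comap (ρ g)
    have : ∃ D ∈ [B1, B2, B3, B4], span k D = S := by
      simp only [List.mem_cons, List.not_mem_nil, or_false] at hS
      rcases hS with rfl | rfl | rfl | rfl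
      exacts [⟨B1, by simp, rfl⟩, ⟨B2, by simp, rfl⟩, ⟨B3, by simp, rfl⟩, ⟨B4, by simp, rfl⟩]
    obtain ⟨D, hD, rfl⟩ := this
    exact span_le.2 fun x hx => subset_span (stable D hD g x hx)
  have stable4 := stable' (span k B4) (by simp)
  have disj {D D' : Set V} (hD : D ⊆ B) (hD' : D' ⊆ B) (h : Disjoint D D') :
      Disjoint (span k D) (span k D') := by
    have := hli.disjoint_span_image (s := (↑) ⁻¹' D) (t := (↑) ⁻¹' D') (h.preimage _)
    rwa [Subtype.image_preimage_coe, Subtype.image_preimage_coe, Set.inter_eq_self_of_subset_right hD,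
      Set.inter_eq_self_of_subset_right hD'] at this
  have sub1 : B1 ⊆ B := fun x hx => hx.1
  have sub2 : B2 ⊆ B := fun x hx => hx.1
  have sub3 : B3 ⊆ B := fun x hx => hx.1
  have sub4 : B4 ⊆ B := fun x hx => hx.1
  let r : Setoid V :=
    { r := fun x y => ∃ g, ρ g x = y
      iseqv :=
        { refl := fun x => ⟨1, one x⟩
          symm := by
            rintro x _ ⟨g, rfl⟩
            exact ⟨g⁻¹, by rw [mul, inv_mul_cancel, one]⟩
          trans := by
            rintro x _ _ ⟨g, rfl⟩ ⟨h, rfl⟩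
            exact ⟨h * g, (mul h g x).symm⟩ } }
  -- a transversal of the orbits
  let T : Set V := {x | (Quotient.mk r x).out = x}
  have hT (x : V) (hx : x ∈ B4) : ∃ g₀, ∀ g, ρ g x ∈ T ↔ g = g₀ := by
    obtain ⟨g₀, hg₀⟩ : ∃ g, ρ g x = (Quotient.mk r x).out := r.symm (Quotient.mk_out (s := r) x)
    have hq (g : KleinV4) : Quotient.mk r (ρ g x) = Quotient.mk r x :=
      Quotient.sound (r.symm ⟨g, rfl⟩)
    have free (g : KleinV4) (h : ρ g x = x) : g = 1 := by
      rcases eq_one_or g with rfl | rfl | rfl | rfl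
      exacts [rfl, absurd h hx.2.2.1, absurd h hx.2.2.2, absurd h hx.2.1]
    refine ⟨g₀, fun g => ?_⟩
    change (Quotient.mk r (ρ g x)).out = ρ g x ↔ _
    rw [hq, ← hg₀]
    refine ⟨fun h => ?_, fun h => by rw [h]⟩
    refine (inv_mul_eq_one.1 (free _ (?_ : ρ (g₀⁻¹ * g) x = x))).symm
    rw [← mul, ← h, mul, inv_mul_cancel, one]
  let bas : Basis B k V := Basis.mk hli (by rw [Subtype.range_coe, hsp])
  let e : End k V := bas.constr k fun x => if (x : V) ∈ T then (x : V) else 0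
  have he (x : V) (hx : x ∈ B) : e x = if x ∈ T then x else 0 := by
    have := bas.constr_basis k (fun x : B => if (x : V) ∈ T then (x : V) else 0) ⟨x, hx⟩
    rwa [Basis.mk_apply] at this
  have he4 : ∀ z ∈ span k B4, e z ∈ span k B4 := by
    change span k B4 ≤ (span k B4).comap e
    refine span_le.2 fun x hx => ?_
    change e x ∈ span k B4
    rw [he x (sub4 hx)]
    split_ifs
    exacts [subset_span hx, zero_mem _]
  have hsum : ∀ z ∈ span k B4,
      e z + ρ σ (e (ρ σ z)) + ρ τ (e (ρ τ z)) + ρ (σ * τ) (e (ρ (σ * τ) z)) = z := by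
    let E : End k V := e + ρ σ * e * ρ σ + ρ τ * e * ρ τ + ρ (σ * τ) * e * ρ (σ * τ)
    change span k B4 ≤ LinearMap.eqLocus E LinearMap.id
    refine span_le.2 fun x hx => ?_
    change e x + ρ σ (e (ρ σ x)) + ρ τ (e (ρ τ x)) + ρ (σ * τ) (e (ρ (σ * τ) x)) = x
    obtain ⟨g₀, hg₀⟩ := hT x hx
    have key (g : KleinV4) : ρ g (e (ρ g x)) = if g = g₀ then x else 0 := by
      rw [he _ (hB g x hx.1)]
      simp only [hg₀ g]
      split_ifs
      · rw [mul, mul_self, one]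
      · exact map_zero _
    have := sum_eq fun g => ρ g (e (ρ g x))
    simp only [key, Finset.sum_ite_eq', Finset.mem_univ, if_true] at this
    rw [← key, ← key, ← key, ← key, one, one] at this
    exact this.symm
  have hσσ (z : V) : ρ σ (ρ σ z) = z := by rw [mul, mul_self, one]
  have hττ (z : V) : ρ τ (ρ τ z) = z := by rw [mul, mul_self, one]
  have hτσ (z : V) : ρ τ (ρ σ z) = ρ σ (ρ τ z) := by rw [mul, mul, mul_comm]
  have hστ (z : V) : ρ (σ * τ) z = ρ σ (ρ τ z) := (mul _ _ _).symm
  have two (z : V) : z + z = 0 := add_self_eq_zero_of_charTwo (k := k) z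
  refine ⟨⟨span k B1, span k B2, span k B3, span k B4, ρ σ * (e + ρ τ * e * ρ τ),
    ρ τ * (e + ρ σ * e * ρ σ), ?_, ?_, ?_, ?_, ?_, ?_, ?_, ?_, ?_, ?_, ?_, ?_, ?_, ?_, ?_⟩⟩
  · exact fun S hS z hz => sub_mem (stable' S hS σ z hz) hz
  · exact fun S hS z hz => sub_mem (stable' S hS τ z hz) hz
  · rw [← span_union, ← span_union, ← span_union, eq_top_iff, ← hsp]
    refine span_mono fun x hx => ?_
    by_cases h1 : ρ σ x = x
    · exact Or.inl (Or.inl (Or.inl ⟨hx, h1⟩))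
    by_cases h2 : ρ τ x = x
    · exact Or.inl (Or.inl (Or.inr ⟨hx, h2, h1⟩))
    by_cases h3 : ρ (σ * τ) x = x
    · exact Or.inl (Or.inr ⟨hx, h3, h1, h2⟩)
    · exact Or.inr ⟨hx, h3, h1, h2⟩
  · exact disj sub1 sub2 (Set.disjoint_left.2 fun x h1 h2 => h2.2.2 h1.2)
  · rw [← span_union]
    refine disj (Set.union_subset sub1 sub2) sub3 (Set.disjoint_left.2 ?_)
    rintro x (h | h) h3
    exacts [h3.2.2.1 h.2, h3.2.2.2 h.2.1]
  · rw [← span_union, ← span_union]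
    refine disj (Set.union_subset (Set.union_subset sub1 sub2) sub3) sub4 (Set.disjoint_left.2 ?_)
    rintro x ((h | h) | h) h4
    exacts [h4.2.2.1 h.2, h4.2.2.2 h.2.1, h4.2.1 h.2.1]
  · change span k B1 ≤ LinearMap.ker (ρ σ - 1)
    exact span_le.2 fun x hx => sub_eq_zero.2 hx.2
  · change span k B2 ≤ LinearMap.ker (ρ τ - 1)
    exact span_le.2 fun x hx => sub_eq_zero.2 hx.2.1
  · have hc : ρ σ - 1 + (ρ τ - 1) + (ρ σ - 1) * (ρ τ - 1) = ρ (σ * τ) - 1 := by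
      rw [map_mul]; noncomm_ring
    rw [hc]
    change span k B3 ≤ LinearMap.ker (ρ (σ * τ) - 1)
    exact span_le.2 fun x hx => sub_eq_zero.2 hx.2.1
  · exact fun z hz => stable4 σ _ (add_mem (he4 z hz) (stable4 τ _ (he4 _ (stable4 τ z hz))))
  · exact fun z hz => stable4 τ _ (add_mem (he4 z hz) (stable4 σ _ (he4 _ (stable4 σ z hz))))
  · intro z hz
    have := hsum z hz
    simp only [hστ] at this
    simp only [LinearMap.sub_apply, LinearMap.add_apply, Module.End.mul_apply,
      Module.End.one_apply, map_add, map_sub, hσσ, hτσ]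
    linear_combination (norm := module) this - two (ρ σ (e z)) - two (ρ σ (ρ τ (e (ρ τ z))))
  · intro z hz
    have := hsum z hz
    simp only [hστ] at this
    simp only [LinearMap.sub_apply, LinearMap.add_apply, Module.End.mul_apply,
      Module.End.one_apply, map_add, map_sub, hττ, hτσ]
    linear_combination (norm := module) this - two (ρ τ (e z)) - two (ρ σ (ρ τ (e (ρ σ z))))
  · intro z
    simp only [LinearMap.sub_apply, LinearMap.add_apply, Module.End.mul_apply,
      Module.End.one_apply, map_add, map_sub, hττ, hτσ]
    abel
  · intro z
    simp only [LinearMap.sub_apply, LinearMap.add_apply, Module.End.mul_apply,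
      Module.End.one_apply, map_add, map_sub, hσσ, hτσ]
    abel

end Decomposition

/-! ### Modules of permutation dimension at most one -/

section RankInequalities

open Module Submodule

variable {k : Type u} [Field k] {V₁ V₀ W : Type*} [AddCommGroup V₁] [Module k V₁]
  [AddCommGroup V₀] [Module k V₀] [AddCommGroup W] [Module k W]

lemma finrank_map_eq_of_injective {i : V₁ →ₗ[k] V₀} (hi : Function.Injective i)
    (A : Submodule k V₁) : finrank k (A.map i) = finrank k A :=
  (LinearEquiv.finrank_eq (Submodule.equivMapOfInjective i hi A)).symm

lemma finrank_add_finrank_le_of_exact [FiniteDimensional k V₀] {i : V₁ →ₗ[k] V₀} {π : V₀ →ₗ[k] W}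
    (hi : Function.Injective i) (hex : Function.Exact i π) {A₁ : Submodule k V₁}
    {A : Submodule k V₀} {A' : Submodule k W} (h₁ : A₁.map i ≤ A) (h : A' ≤ A.map π) :
    finrank k A₁ + finrank k A' ≤ finrank k A := by
  rw [← finrank_map_add_finrank_inf_ker A π, ← finrank_map_eq_of_injective hi, add_comm]
  refine add_le_add (Submodule.finrank_mono h) (Submodule.finrank_mono (le_inf h₁ ?_))
  rw [hex.linearMap_ker_eq]
  exact LinearMap.map_le_range

lemma finrank_le_finrank_add_of_exact [FiniteDimensional k V₁] [FiniteDimensional k V₀]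
    [FiniteDimensional k W] {i : V₁ →ₗ[k] V₀}
    {π : V₀ →ₗ[k] W} (hex : Function.Exact i π) {A₁ : Submodule k V₁}
    {A : Submodule k V₀} {A' : Submodule k W} (h₁ : ∀ y, i y ∈ A → y ∈ A₁)
    (h : ∀ z ∈ A, π z ∈ A') : finrank k A ≤ finrank k A₁ + finrank k A' := by
  rw [← finrank_map_add_finrank_inf_ker A π, add_comm]
  refine add_le_add ((Submodule.finrank_mono ?_).trans (Submodule.finrank_map_le i A₁))
    (Submodule.finrank_mono (Submodule.map_le_iff_le_comap.2 h))
  rintro z ⟨hz, hπ⟩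
  obtain ⟨y, rfl⟩ := (hex z).1 hπ
  exact ⟨y, h₁ y hz, rfl⟩

/-- For compatible square-zero operators on a short exact sequence, the long exact sequence of
their homology bounds the rank on the middle term. -/
lemma finrank_range_le_of_exact [FiniteDimensional k V₁] [FiniteDimensional k V₀]
    [FiniteDimensional k W] {i : V₁ →ₗ[k] V₀} {π : V₀ →ₗ[k] W}
    (hi : Function.Injective i) (hex : Function.Exact i π) (hπ : Function.Surjective π)
    {x₁ : End k V₁} {x₀ : End k V₀} {x : End k W} (hx₀ : x₀ * x₀ = 0)
    (hxi : ∀ y, i (x₁ y) = x₀ (i y)) (hxπ : ∀ z, π (x₀ z) = x (π z)) :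
    finrank k (LinearMap.range x₀) ≤
      finrank k (LinearMap.range x₁) + finrank k (LinearMap.ker x) := by
  have h : finrank k (LinearMap.ker x₁) + finrank k (LinearMap.range x) ≤
      finrank k (LinearMap.ker x₀) := by
    refine finrank_add_finrank_le_of_exact hi hex ?_ ?_
    · rintro _ ⟨y, hy, rfl⟩
      rw [LinearMap.mem_ker, ← hxi, LinearMap.mem_ker.1 hy, map_zero]
    · rintro _ ⟨w, rfl⟩
      obtain ⟨z, rfl⟩ := hπ w
      refine ⟨x₀ z, ?_, hxπ z⟩
      rw [SetLike.mem_coe, LinearMap.mem_ker, ← Module.End.mul_apply, hx₀, LinearMap.zero_apply]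
  have hd : finrank k V₀ ≤ finrank k V₁ + finrank k W := by
    rw [← finrank_top k V₀, ← finrank_top k V₁, ← finrank_top k W]
    exact finrank_le_finrank_add_of_exact hex (fun _ _ => trivial) (fun _ _ => trivial)
  have h₀ := LinearMap.finrank_range_add_finrank_ker x₀
  have h₁ := LinearMap.finrank_range_add_finrank_ker x₁
  have h' := LinearMap.finrank_range_add_finrank_ker x
  omega

lemma map_top_eq_range {V : Type*} [AddCommGroup V] [Module k V] (x : End k V) :
    (⊤ : Submodule k V).map x = LinearMap.range x := Submodule.map_top x

/-- If `W` is the cokernel of an injection of modules with a Klein decomposition and `N` is a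
submodule of `W` containing the images and the kernels of `a`, `b`, `a + b + ab` and, after
extension of scalars, of `a + ωb`, then `4 (dim W - dim N) ≤ 3 dim N`. -/
theorem four_mul_finrank_le_of_kleinDecomposition [FiniteDimensional k V₁] [FiniteDimensional k V₀]
    [FiniteDimensional k W] [CharP k 2] {i : V₁ →ₗ[k] V₀} {π : V₀ →ₗ[k] W}
    (hi : Function.Injective i) (hex : Function.Exact i π) (hπ : Function.Surjective π)
    {a₁ b₁ : End k V₁} {a₀ b₀ : End k V₀} {a b : End k W}
    (D₁ : KleinDecomposition a₁ b₁) (D₀ : KleinDecomposition a₀ b₀)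
    (ha₁ : a₁ * a₁ = 0) (hb₁ : b₁ * b₁ = 0) (hab₁ : a₁ * b₁ = b₁ * a₁)
    (ha₀ : a₀ * a₀ = 0) (hb₀ : b₀ * b₀ = 0) (hab₀ : a₀ * b₀ = b₀ * a₀)
    (hai : ∀ y, i (a₁ y) = a₀ (i y)) (hbi : ∀ y, i (b₁ y) = b₀ (i y))
    (haπ : ∀ z, π (a₀ z) = a (π z)) (hbπ : ∀ z, π (b₀ z) = b (π z))
    {N : Submodule k W} (hNa : ∀ w, a w ∈ N) (hNb : ∀ w, b w ∈ N)
    (hka : ∀ w, a w = 0 → w ∈ N) (hkb : ∀ w, b w = 0 → w ∈ N)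
    (hkc : ∀ w, (a + b + a * b) w = 0 → w ∈ N)
    (hkq : ∀ w, quadPencil a b w = 0 → w ∈ N.prod N) :
    4 * finrank k W ≤ 7 * finrank k N := by
  have I₁ := D₁.rankIdentity ha₁ hb₁ hab₁
  have I₀ := D₀.rankIdentity ha₀ hb₀ hab₀
  rw [RankIdentity, Submodule.prod_top] at I₁ I₀
  iterate 5 rw [map_top_eq_range] at I₁ I₀
  have ra := finrank_range_le_of_exact hi hex hπ ha₀ hai haπ
  have rb := finrank_range_le_of_exact hi hex hπ hb₀ hbi hbπ
  have rc := finrank_range_le_of_exact hi hex hπ (x₁ := a₁ + b₁ + a₁ * b₁)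
    (x := a + b + a * b) (add_add_mul_sq_eq_zero ha₀ hb₀ hab₀)
    (fun y => by simp [hai, hbi]) (fun z => by simp [haπ, hbπ])
  have ka : finrank k (LinearMap.ker a) ≤ finrank k N := Submodule.finrank_mono hka
  have kb : finrank k (LinearMap.ker b) ≤ finrank k N := Submodule.finrank_mono hkb
  have kc : finrank k (LinearMap.ker (a + b + a * b)) ≤ finrank k N := Submodule.finrank_mono hkc
  have kq : finrank k (LinearMap.ker (quadPencil a b)) ≤ 2 * finrank k N :=
    (Submodule.finrank_mono hkq).trans_eq (finrank_prod_submodule N)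
  -- The rank of the pencil grows by at least `2 (dim W - dim N)`.
  have dq := LinearMap.finrank_range_add_finrank_ker (quadPencil a b)
  rw [Module.finrank_prod] at dq
  have rq : finrank k (LinearMap.range (quadPencil a₁ b₁)) +
      finrank k (LinearMap.range (quadPencil a b)) ≤
        finrank k (LinearMap.range (quadPencil a₀ b₀)) := by
    refine finrank_add_finrank_le_of_exact (i := i.prodMap i) (π := π.prodMap π)
      (hi.prodMap hi) ?_ ?_ ?_
    · rintro ⟨z, z'⟩
      constructor
      · intro h
        obtain ⟨y, rfl⟩ := (hex z).1 (congrArg Prod.fst h)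
        obtain ⟨y', rfl⟩ := (hex z').1 (congrArg Prod.snd h)
        exact ⟨(y, y'), rfl⟩
      · rintro ⟨⟨y, y'⟩, h⟩
        rw [← h]
        exact Prod.ext (hex.apply_apply_eq_zero y) (hex.apply_apply_eq_zero y')
    · rintro _ ⟨_, ⟨y, rfl⟩, rfl⟩
      exact ⟨(i y.1, i y.2), by simp [hai, hbi]⟩
    · rintro _ ⟨⟨w, w'⟩, rfl⟩
      obtain ⟨z, rfl⟩ := hπ w
      obtain ⟨z', rfl⟩ := hπ w'
      exact ⟨_, ⟨(z, z'), rfl⟩, by simp [haπ, hbπ]⟩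
  -- The rank of `ab` grows by at least `dim W - dim N`.
  have rn : finrank k (LinearMap.ker (a₀ * b₀)) ≤
      finrank k (LinearMap.ker (a₁ * b₁)) + finrank k N := by
    refine finrank_le_finrank_add_of_exact hex (fun y hy => hi ?_) fun z hz =>
      D₀.map_mem_of_mul_apply_eq_zero ha₀ hab₀ hNa hNb hka hkb hkc haπ hbπ hz
    rw [LinearMap.mem_ker] at hy
    simpa [hai, hbi] using hy
  have d₀ := LinearMap.finrank_range_add_finrank_ker (a₀ * b₀)
  have d₁ := LinearMap.finrank_range_add_finrank_ker (a₁ * b₁)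
  have hd : finrank k V₁ + finrank k W ≤ finrank k V₀ := by
    rw [← finrank_top k V₀, ← finrank_top k V₁, ← finrank_top k W]
    refine finrank_add_finrank_le_of_exact hi hex le_top ?_
    rw [Submodule.map_top, LinearMap.range_eq_top.2 hπ]
  omega

end RankInequalities

section MSpace

open Module

variable {k : Type u} [Field k] {n : ℕ}

lemma MSpace.a_apply (z : MSpace k n) :
    MSpace.a k n z = ∑ i, z (Sum.inl i) • Finsupp.single (Sum.inr i.castSucc) 1 := by
  rw [MSpace.a, Finsupp.linearCombination_apply, Finsupp.sum_fintype _ _ (by simp)]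
  simp

lemma MSpace.b_apply (z : MSpace k n) :
    MSpace.b k n z = ∑ i, z (Sum.inl i) • Finsupp.single (Sum.inr i.succ) 1 := by
  rw [MSpace.b, Finsupp.linearCombination_apply, Finsupp.sum_fintype _ _ (by simp)]
  simp

lemma MSpace.a_apply_castSucc (z : MSpace k n) (i : Fin n) :
    MSpace.a k n z (Sum.inr i.castSucc) = z (Sum.inl i) := by
  simp [MSpace.a_apply, Finsupp.single_apply]

lemma MSpace.b_apply_succ (z : MSpace k n) (i : Fin n) :
    MSpace.b k n z (Sum.inr i.succ) = z (Sum.inl i) := by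
  simp [MSpace.b_apply, Finsupp.single_apply]

lemma MSpace.b_apply_zero (z : MSpace k n) : MSpace.b k n z (Sum.inr 0) = 0 := by
  simp [MSpace.b_apply]

/-- The span of the basis vectors `v₀, …, vₙ`. -/
noncomputable def MSpace.socle (k : Type u) [Field k] (n : ℕ) : Submodule k (MSpace k n) :=
  ⨅ i : Fin n, LinearMap.ker (Finsupp.lapply (Sum.inl i))

lemma MSpace.mem_socle {z : MSpace k n} : z ∈ MSpace.socle k n ↔ ∀ i, z (Sum.inl i) = 0 := by
  simp [MSpace.socle]

lemma MSpace.a_mem_socle (z : MSpace k n) : MSpace.a k n z ∈ MSpace.socle k n := by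
  simp [MSpace.mem_socle, MSpace.a_apply]

lemma MSpace.b_mem_socle (z : MSpace k n) : MSpace.b k n z ∈ MSpace.socle k n := by
  simp [MSpace.mem_socle, MSpace.b_apply]

lemma MSpace.finrank_socle_le : finrank k (MSpace.socle k n) ≤ n + 1 := by
  let f : MSpace.socle k n →ₗ[k] (Fin (n + 1) → k) :=
    LinearMap.pi fun j => Finsupp.lapply (Sum.inr j) ∘ₗ (MSpace.socle k n).subtype
  have hf : Function.Injective f := by
    rw [injective_iff_map_eq_zero]
    intro z hz
    ext i
    rcases i with i | j
    · exact MSpace.mem_socle.1 z.2 i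
    · exact congrFun hz j
  simpa using LinearMap.finrank_le_finrank_of_injective hf

/-- The operator `a + ωb` on `M ⊗ k[ω]` is injective on the span of the `uᵢ`: the coefficients of a
vector in its kernel vanish one after the other, as `v₀` only occurs in `a u₁`. -/
lemma MSpace.mem_socle_of_quadPencil_eq_zero {w : MSpace k n × MSpace k n}
    (hw : quadPencil (MSpace.a k n) (MSpace.b k n) w = 0) :
    w ∈ (MSpace.socle k n).prod (MSpace.socle k n) := by
  have h1 (j : Fin (n + 1)) := DFunLike.congr_fun (congrArg Prod.fst hw) (Sum.inr j)
  have h2 (j : Fin (n + 1)) := DFunLike.congr_fun (congrArg Prod.snd hw) (Sum.inr j)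
  simp only [quadPencil_apply, Finsupp.add_apply, Prod.fst_zero, Prod.snd_zero,
    Finsupp.zero_apply] at h1 h2
  have key : ∀ m (hm : m < n), w.1 (Sum.inl ⟨m, hm⟩) = 0 ∧ w.2 (Sum.inl ⟨m, hm⟩) = 0 := by
    intro m
    induction m with
    | zero =>
      intro hm
      have e1 := h1 (Fin.castSucc ⟨0, hm⟩)
      have e2 := h2 (Fin.castSucc ⟨0, hm⟩)
      rw [MSpace.a_apply_castSucc] at e1 e2
      have : (Fin.castSucc ⟨0, hm⟩ : Fin (n + 1)) = 0 := rfl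
      simp only [this, MSpace.b_apply_zero, add_zero, zero_add] at e1 e2
      exact ⟨e1, e2⟩
    | succ m ih =>
      intro hm
      obtain ⟨i1, i2⟩ := ih (by omega)
      have e1 := h1 (Fin.castSucc ⟨m + 1, hm⟩)
      have e2 := h2 (Fin.castSucc ⟨m + 1, hm⟩)
      rw [MSpace.a_apply_castSucc] at e1 e2
      have : (Fin.castSucc ⟨m + 1, hm⟩ : Fin (n + 1)) = Fin.succ ⟨m, by omega⟩ := rfl
      simp only [this, MSpace.b_apply_succ, i1, i2, add_zero, zero_add] at e1 e2
      exact ⟨e1, e2⟩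
  exact ⟨MSpace.mem_socle.2 fun i => (key i i.2).1, MSpace.mem_socle.2 fun i => (key i i.2).2⟩

lemma MSpace.mem_socle_of_add_add_mul_eq_zero {w : MSpace k n}
    (hw : (MSpace.a k n + MSpace.b k n + MSpace.a k n * MSpace.b k n) w = 0) :
    w ∈ MSpace.socle k n := by
  have h0 : MSpace.a k n (MSpace.b k n w) = 0 := by
    rw [MSpace.a_apply]
    simp [MSpace.mem_socle.1 (MSpace.b_mem_socle w)]
  rw [LinearMap.add_apply, Module.End.mul_apply, h0, add_zero, LinearMap.add_apply] at hw
  have h (j : Fin (n + 1)) := DFunLike.congr_fun hw (Sum.inr j)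
  simp only [Finsupp.add_apply, Finsupp.zero_apply] at h
  have key : ∀ m (hm : m < n), w (Sum.inl ⟨m, hm⟩) = 0 := by
    intro m
    induction m with
    | zero =>
      intro hm
      have e := h (Fin.castSucc ⟨0, hm⟩)
      rw [MSpace.a_apply_castSucc] at e
      have : (Fin.castSucc ⟨0, hm⟩ : Fin (n + 1)) = 0 := rfl
      simpa only [this, MSpace.b_apply_zero, add_zero] using e
    | succ m ih =>
      intro hm
      have e := h (Fin.castSucc ⟨m + 1, hm⟩)
      rw [MSpace.a_apply_castSucc] at e
      have : (Fin.castSucc ⟨m + 1, hm⟩ : Fin (n + 1)) = Fin.succ ⟨m, by omega⟩ := rfl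
      simpa only [this, MSpace.b_apply_succ, ih, add_zero] using e
  exact MSpace.mem_socle.2 fun i => key i i.2

lemma kleinRep_σ [CharP k 2] {V : Type v} [AddCommGroup V] [Module k V] {a b : End k V}
    (ha : a * a = 0) (hb : b * b = 0) (hab : a * b = b * a) : kleinRep a b ha hb hab σ = 1 + a := by
  change (1 + a) ^ 1 * (1 + b) ^ 0 = _
  simp

lemma kleinRep_τ [CharP k 2] {V : Type v} [AddCommGroup V] [Module k V] {a b : End k V}
    (ha : a * a = 0) (hb : b * b = 0) (hab : a * b = b * a) : kleinRep a b ha hb hab τ = 1 + b := by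
  change (1 + a) ^ 0 * (1 + b) ^ 1 = _
  simp

lemma sub_one_mul_self_eq_zero [CharP k 2] {V : Type v} [AddCommGroup V] [Module k V] {x : End k V}
    (hx : x * x = 1) : (x - 1) * (x - 1) = 0 := by
  ext z
  have h := LinearMap.congr_fun hx z
  have two := add_self_eq_zero_of_charTwo (k := k) (V := V)
  simp only [Module.End.mul_apply, Module.End.one_apply] at h
  simp only [Module.End.mul_apply, Module.End.one_apply, LinearMap.sub_apply, map_sub, h,
    LinearMap.zero_apply]
  linear_combination (norm := module) two z - two (x z)

lemma sub_one_sq_eq_zero [CharP k 2] {V : Type v} [AddCommGroup V] [Module k V]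
    (ρ : Representation k KleinV4 V) (g : KleinV4) : (ρ g - 1) * (ρ g - 1) = 0 :=
  sub_one_mul_self_eq_zero (by rw [← map_mul, mul_self, map_one])

lemma sub_one_mul_comm {V : Type v} [AddCommGroup V] [Module k V]
    (ρ : Representation k KleinV4 V) (g h : KleinV4) :
    (ρ g - 1) * (ρ h - 1) = (ρ h - 1) * (ρ g - 1) := by
  have : ρ g * ρ h = ρ h * ρ g := by rw [← map_mul, ← map_mul, mul_comm]
  rw [sub_mul, mul_sub, sub_mul, mul_sub, this]
  noncomm_ring

/-- For `n ≥ 4`, the module `M_{2n+1}` is not the cokernel of an injection of permutation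
modules. -/
theorem MRep_le_three_of_exact [CharP k 2] {V₁ V₀ : Type*} [AddCommGroup V₁] [Module k V₁]
    [AddCommGroup V₀] [Module k V₀] [FiniteDimensional k V₀] [FiniteDimensional k V₁]
    {ρ₁ : Representation k KleinV4 V₁} {ρ₀ : Representation k KleinV4 V₀}
    (h₁ : IsPPermutation 2 ρ₁) (h₀ : IsPPermutation 2 ρ₀)
    (d : ρ₁.IntertwiningMap ρ₀) (ε : ρ₀.IntertwiningMap (MRep k n))
    (hd : Function.Injective d) (hex : Function.Exact d ε) (hε : Function.Surjective ε) :
    n ≤ 3 := by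
  obtain ⟨D₁⟩ := h₁.nonempty_kleinDecomposition
  obtain ⟨D₀⟩ := h₀.nonempty_kleinDecomposition
  have hσ (z : MSpace k n) : MRep k n σ z = z + MSpace.a k n z := by
    rw [MRep, kleinRep_σ]; rfl
  have hτ (z : MSpace k n) : MRep k n τ z = z + MSpace.b k n z := by
    rw [MRep, kleinRep_τ]; rfl
  have hd' (g : KleinV4) (y : V₁) :
      d.toLinearMap ((ρ₁ g - 1) y) = (ρ₀ g - 1) (d.toLinearMap y) := by
    rw [LinearMap.sub_apply, map_sub]
    exact congrArg₂ _ (d.isIntertwining _ _ g y) rfl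
  have key := four_mul_finrank_le_of_kleinDecomposition (i := d.toLinearMap) (π := ε.toLinearMap)
    hd hex hε D₁ D₀ (sub_one_sq_eq_zero ρ₁ σ) (sub_one_sq_eq_zero ρ₁ τ) (sub_one_mul_comm ρ₁ σ τ)
    (sub_one_sq_eq_zero ρ₀ σ) (sub_one_sq_eq_zero ρ₀ τ) (sub_one_mul_comm ρ₀ σ τ)
    (hd' σ) (hd' τ) (a := MSpace.a k n) (b := MSpace.b k n)
    (fun z => by
      rw [LinearMap.sub_apply, map_sub]
      exact (congrArg₂ _ ((ε.isIntertwining _ _ σ z).trans (hσ _)) rfl).trans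
        (add_sub_cancel_left _ _))
    (fun z => by
      rw [LinearMap.sub_apply, map_sub]
      exact (congrArg₂ _ ((ε.isIntertwining _ _ τ z).trans (hτ _)) rfl).trans
        (add_sub_cancel_left _ _))
    MSpace.a_mem_socle MSpace.b_mem_socle
    (fun w hw => MSpace.mem_socle.2 fun i => by rw [← MSpace.a_apply_castSucc, hw]; rfl)
    (fun w hw => MSpace.mem_socle.2 fun i => by rw [← MSpace.b_apply_succ, hw]; rfl)
    (fun w => MSpace.mem_socle_of_add_add_mul_eq_zero)
    (fun w => MSpace.mem_socle_of_quadPencil_eq_zero)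
  have hdim : finrank k (MSpace k n) = n + (n + 1) := by simp
  have := MSpace.finrank_socle_le (k := k) (n := n)
  omega

end MSpace

/-! ### A resolution of length two -/

section LengthTwo

variable {k : Type u} [Field k] {G : Type w} [Group G] {p : ℕ}

lemma isPPermutation_of_subsingleton [Fact p.Prime] {V : Type v} [AddCommGroup V] [Module k V]
    [Subsingleton V] (ρ : Representation k G V) : IsPPermutation p ρ :=
  ⟨default, ∅, linearIndependent_empty_type, Subsingleton.elim _ _, by simp⟩

/-- The sequence of types `X₀, X₁, X₂, 0, 0, …`. -/
def threeTerm (X₀ X₁ X₂ : Type u) : ℕ → Type u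
  | 0 => X₀
  | 1 => X₁
  | 2 => X₂
  | _ + 3 => PUnit.{u + 1}

/-- An exact sequence `0 → X₂ → X₁ → X₀ → V → 0`, extended by zero, is a resolution of length at
most two. -/
lemma ppdim_le_two [Fact p.Prime] {V : Type v} [AddCommGroup V] [Module k V]
    {ρ : Representation k G V} {X₀ X₁ X₂ : Type u} [A₀ : AddCommGroup X₀] [M₀ : Module k X₀]
    [A₁ : AddCommGroup X₁] [M₁ : Module k X₁] [A₂ : AddCommGroup X₂] [M₂ : Module k X₂]
    [F₀ : Module.Finite k X₀] [F₁ : Module.Finite k X₁] [F₂ : Module.Finite k X₂]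
    {ρ₀ : Representation k G X₀} {ρ₁ : Representation k G X₁} {ρ₂ : Representation k G X₂}
    (h₀ : IsPPermutation p ρ₀) (h₁ : IsPPermutation p ρ₁) (h₂ : IsPPermutation p ρ₂)
    (d₁ : ρ₂.IntertwiningMap ρ₁) (d₀ : ρ₁.IntertwiningMap ρ₀) (ε : ρ₀.IntertwiningMap ρ)
    (hd : Function.Injective d₁) (hex₁ : Function.Exact d₁ d₀) (hex₀ : Function.Exact d₀ ε)
    (hε : Function.Surjective ε) : ppdim p ρ ≤ 2 := by
  let iA : ∀ i, AddCommGroup (threeTerm X₀ X₁ X₂ i)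
    | 0 => A₀
    | 1 => A₁
    | 2 => A₂
    | _ + 3 => (inferInstance : AddCommGroup PUnit.{u + 1})
  let iM : ∀ i, Module k (threeTerm X₀ X₁ X₂ i)
    | 0 => M₀
    | 1 => M₁
    | 2 => M₂
    | _ + 3 => (inferInstance : Module k PUnit.{u + 1})
  have iF : ∀ i, Module.Finite k (threeTerm X₀ X₁ X₂ i)
    | 0 => F₀
    | 1 => F₁
    | 2 => F₂
    | _ + 3 => (inferInstance : Module.Finite k PUnit.{u + 1})
  have iS (i : ℕ) : Subsingleton (threeTerm X₀ X₁ X₂ (i + 3)) :=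
    inferInstanceAs (Subsingleton PUnit.{u + 1})
  let rep : ∀ i, Representation k G (threeTerm X₀ X₁ X₂ i)
    | 0 => ρ₀
    | 1 => ρ₁
    | 2 => ρ₂
    | i + 3 => Representation.trivial k G (threeTerm X₀ X₁ X₂ (i + 3))
  let d : ∀ i, (rep (i + 1)).IntertwiningMap (rep i)
    | 0 => d₀
    | 1 => d₁
    | _ + 2 => 0
  let R : PPermutationResolution p ρ :=
    { X := threeTerm X₀ X₁ X₂
      addCommGroup := iA
      module := iM
      finite := iF
      rep := rep
      isPPermutation := fun i => match i with
        | 0 => h₀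
        | 1 => h₁
        | 2 => h₂
        | _ + 3 => isPPermutation_of_subsingleton _
      d := d
      ε := ε
      exact_d := fun i => match i with
        | 0 => hex₁
        | 1 => fun x => by
          constructor
          · intro h
            refine ⟨0, ?_⟩
            rw [map_zero]
            exact (hd (h.trans (map_zero d₁).symm)).symm
          · rintro ⟨y, rfl⟩
            exact map_zero d₁
        | i + 2 => fun x => ⟨fun _ => ⟨0, Subsingleton.elim _ _⟩, fun _ => rfl⟩
      exact_ε := hex₀
      surjective_ε := hε }
  refine (iInf_le _ R).trans (iSup₂_le fun i hi => ?_)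
  rcases i with _ | _ | _ | i
  · simp
  · norm_num
  · norm_num
  · exact absurd (iS i) (not_subsingleton_iff_nontrivial.2 hi)

end LengthTwo

section PermutationModules

open Module

variable {k : Type u} [Field k]

lemma isPPermutation_of_basis {V : Type v} [AddCommGroup V] [Module k V]
    {ρ : Representation k KleinV4 V} {ι : Type*} (b : Basis ι k V)
    (hσ : ∀ i, ∃ j, ρ σ (b i) = b j) (hτ : ∀ i, ∃ j, ρ τ (b i) = b j) : IsPPermutation 2 ρ := by
  refine ⟨default, Set.range b, b.linearIndependent.linearIndepOn_id, b.span_eq, ?_⟩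
  rintro g - _ ⟨i, rfl⟩
  rcases eq_one_or g with rfl | rfl | rfl | rfl
  · exact ⟨i, by simp⟩
  · obtain ⟨j, hj⟩ := hσ i
    exact ⟨j, hj.symm⟩
  · obtain ⟨j, hj⟩ := hτ i
    exact ⟨j, hj.symm⟩
  · obtain ⟨j, hj⟩ := hτ i
    obtain ⟨l, hl⟩ := hσ j
    exact ⟨l, by rw [map_mul, Module.End.mul_apply, hj, hl]⟩

/-- A linear map commuting with the two generators is a map of representations. -/
def intertwiningMapOfGenerators {V W : Type*} [AddCommGroup V] [Module k V] [AddCommGroup W]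
    [Module k W] {ρ : Representation k KleinV4 V} {ρ' : Representation k KleinV4 W}
    (f : V →ₗ[k] W) (hσ : ∀ z, f (ρ σ z) = ρ' σ (f z)) (hτ : ∀ z, f (ρ τ z) = ρ' τ (f z)) :
    ρ.IntertwiningMap ρ' :=
  f.intertwiningMap_of_isIntertwiningMap ρ ρ' (fun g z => by
    rcases eq_one_or g with rfl | rfl | rfl | rfl
    · simp
    · exact hσ z
    · exact hτ z
    · rw [map_mul, map_mul, Module.End.mul_apply, Module.End.mul_apply, hσ, hτ])

variable [CharP k 2]

/-- The representation of the Klein four-group given by two commuting involutions. -/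
def involutionRep {V : Type v} [AddCommGroup V] [Module k V] (s t : End k V) (hs : s * s = 1)
    (ht : t * t = 1) (hst : s * t = t * s) : Representation k KleinV4 V :=
  kleinRep (s - 1) (t - 1) (sub_one_mul_self_eq_zero hs) (sub_one_mul_self_eq_zero ht)
    (by rw [sub_mul, mul_sub, sub_mul, mul_sub, hst]; noncomm_ring)

variable {V : Type v} [AddCommGroup V] [Module k V] {s t : End k V}

lemma involutionRep_σ (hs : s * s = 1) (ht : t * t = 1) (hst : s * t = t * s) :
    involutionRep s t hs ht hst σ = s := by
  rw [involutionRep, kleinRep_σ, add_sub_cancel]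

lemma involutionRep_τ (hs : s * s = 1) (ht : t * t = 1) (hst : s * t = t * s) :
    involutionRep s t hs ht hst τ = t := by
  rw [involutionRep, kleinRep_τ, add_sub_cancel]

end PermutationModules

section Resolution

open Module

variable {k : Type u} [Field k] [CharP k 2]

/-- The free module `kV₄ ⊗ U` together with a trivial summand `W`. A vector
`(((x₁, x_σ), (x_τ, x_στ)), w)` records the coefficients of the group elements. -/
def freeTrivialRep (k : Type u) [Field k] [CharP k 2] (U W : Type u) [AddCommGroup U] [Module k U]
    [AddCommGroup W] [Module k W] : Representation k KleinV4 (((U × U) × (U × U)) × W) :=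
  involutionRep
    ((((LinearEquiv.prodComm k U U).toLinearMap.prodMap
      (LinearEquiv.prodComm k U U).toLinearMap)).prodMap LinearMap.id)
    ((LinearEquiv.prodComm k (U × U) (U × U)).toLinearMap.prodMap LinearMap.id)
    (LinearMap.ext fun _ => rfl) (LinearMap.ext fun _ => rfl) (LinearMap.ext fun _ => rfl)

/-- The direct sum of `k[V₄/⟨σ⟩] ⊗ U` and `k[V₄/⟨τ⟩] ⊗ U`: on `((y₀, y₁), (z₀, z₁))`, the
involution `τ` exchanges `y₀` and `y₁`, and `σ` exchanges `z₀` and `z₁`. -/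
def cosetRep (k : Type u) [Field k] [CharP k 2] (U : Type u) [AddCommGroup U] [Module k U] :
    Representation k KleinV4 ((U × U) × (U × U)) :=
  involutionRep
    (LinearMap.id.prodMap (LinearEquiv.prodComm k U U).toLinearMap)
    ((LinearEquiv.prodComm k U U).toLinearMap.prodMap LinearMap.id)
    (LinearMap.ext fun _ => rfl) (LinearMap.ext fun _ => rfl) (LinearMap.ext fun _ => rfl)

section

variable {U W : Type u} [AddCommGroup U] [Module k U] [AddCommGroup W] [Module k W]

lemma freeTrivialRep_σ (x : ((U × U) × (U × U)) × W) : freeTrivialRep k U W σ x =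
    (((x.1.1.2, x.1.1.1), (x.1.2.2, x.1.2.1)), x.2) := by
  rw [freeTrivialRep, involutionRep_σ]; rfl

lemma freeTrivialRep_τ (x : ((U × U) × (U × U)) × W) : freeTrivialRep k U W τ x =
    ((x.1.2, x.1.1), x.2) := by
  rw [freeTrivialRep, involutionRep_τ]; rfl

lemma cosetRep_σ (x : (U × U) × (U × U)) : cosetRep k U σ x = (x.1, (x.2.2, x.2.1)) := by
  rw [cosetRep, involutionRep_σ]; rfl

lemma cosetRep_τ (x : (U × U) × (U × U)) : cosetRep k U τ x = ((x.1.2, x.1.1), x.2) := by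
  rw [cosetRep, involutionRep_τ]; rfl

lemma isPPermutation_freeTrivialRep : IsPPermutation 2 (freeTrivialRep k U W) := by
  let b := Basis.ofVectorSpace k U
  let c := Basis.ofVectorSpace k W
  refine isPPermutation_of_basis (((b.prod b).prod (b.prod b)).prod c) ?_ ?_
  · rintro (((i | i) | (i | i)) | j)
    · exact ⟨Sum.inl (Sum.inl (Sum.inr i)), by simp [freeTrivialRep_σ, Basis.prod_apply]⟩
    · exact ⟨Sum.inl (Sum.inl (Sum.inl i)), by simp [freeTrivialRep_σ, Basis.prod_apply]⟩
    · exact ⟨Sum.inl (Sum.inr (Sum.inr i)), by simp [freeTrivialRep_σ, Basis.prod_apply]⟩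
    · exact ⟨Sum.inl (Sum.inr (Sum.inl i)), by simp [freeTrivialRep_σ, Basis.prod_apply]⟩
    · exact ⟨Sum.inr j, by simp [freeTrivialRep_σ, Basis.prod_apply]⟩
  · rintro (((i | i) | (i | i)) | j)
    · exact ⟨Sum.inl (Sum.inr (Sum.inl i)), by simp [freeTrivialRep_τ, Basis.prod_apply]⟩
    · exact ⟨Sum.inl (Sum.inr (Sum.inr i)), by simp [freeTrivialRep_τ, Basis.prod_apply]⟩
    · exact ⟨Sum.inl (Sum.inl (Sum.inl i)), by simp [freeTrivialRep_τ, Basis.prod_apply]⟩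
    · exact ⟨Sum.inl (Sum.inl (Sum.inr i)), by simp [freeTrivialRep_τ, Basis.prod_apply]⟩
    · exact ⟨Sum.inr j, by simp [freeTrivialRep_τ, Basis.prod_apply]⟩

lemma isPPermutation_cosetRep : IsPPermutation 2 (cosetRep k U) := by
  let b := Basis.ofVectorSpace k U
  refine isPPermutation_of_basis ((b.prod b).prod (b.prod b)) ?_ ?_
  · rintro ((i | i) | (i | i))
    · exact ⟨Sum.inl (Sum.inl i), by simp [cosetRep_σ, Basis.prod_apply]⟩
    · exact ⟨Sum.inl (Sum.inr i), by simp [cosetRep_σ, Basis.prod_apply]⟩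
    · exact ⟨Sum.inr (Sum.inr i), by simp [cosetRep_σ, Basis.prod_apply]⟩
    · exact ⟨Sum.inr (Sum.inl i), by simp [cosetRep_σ, Basis.prod_apply]⟩
  · rintro ((i | i) | (i | i))
    · exact ⟨Sum.inl (Sum.inr i), by simp [cosetRep_τ, Basis.prod_apply]⟩
    · exact ⟨Sum.inl (Sum.inl i), by simp [cosetRep_τ, Basis.prod_apply]⟩
    · exact ⟨Sum.inr (Sum.inl i), by simp [cosetRep_τ, Basis.prod_apply]⟩
    · exact ⟨Sum.inr (Sum.inr i), by simp [cosetRep_τ, Basis.prod_apply]⟩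

/-- Let `σ - 1` and `τ - 1` act on `V ≅ U × W` by `(u, w) ↦ (0, A u)` and `(u, w) ↦ (0, B u)`. The
kernel of the map from `(kV₄ ⊗ U) ⊕ W` to `V` is isomorphic to `rad(kV₄) ⊗ U`, since `W` already
covers the radical of `V`. In turn `rad(kV₄)` is generated by `σ - 1` and `τ - 1`, and is the
quotient of `k[V₄/⟨σ⟩] ⊕ k[V₄/⟨τ⟩]` by a trivial submodule. -/
theorem ppdim_le_two_of_radical_sq_eq_zero [FiniteDimensional k U] [FiniteDimensional k W]
    {V : Type v} [AddCommGroup V] [Module k V] {ρ : Representation k KleinV4 V}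
    (A B : U →ₗ[k] W) (φ : (U × W) ≃ₗ[k] V)
    (hσ : ∀ z, ρ σ (φ z) = φ (z.1, A z.1 + z.2)) (hτ : ∀ z, ρ τ (φ z) = φ (z.1, B z.1 + z.2)) :
    ppdim 2 ρ ≤ 2 := by
  have twoU : ∀ z : U, z + z = 0 := add_self_eq_zero_of_charTwo (k := k)
  have twoW : ∀ z : W, z + z = 0 := add_self_eq_zero_of_charTwo (k := k)
  let ε' : (((U × U) × (U × U)) × W) →ₗ[k] U × W :=
    { toFun := fun x => (x.1.1.1 + x.1.1.2 + x.1.2.1 + x.1.2.2,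
        A (x.1.1.2 + x.1.2.2) + B (x.1.2.1 + x.1.2.2) + x.2)
      map_add' := fun x y => by ext <;> simp <;> abel
      map_smul' := fun c x => by ext <;> simp }
  let d' : ((U × U) × (U × U)) →ₗ[k] (((U × U) × (U × U)) × W) :=
    { toFun := fun y => (((y.1.1 + y.2.1, y.1.1 + y.2.2), (y.1.2 + y.2.1, y.1.2 + y.2.2)),
        A (y.1.1 + y.1.2) + B (y.2.1 + y.2.2))
      map_add' := fun x y => by ext <;> simp <;> abel
      map_smul' := fun c x => by ext <;> simp }
  let d'' : U →ₗ[k] ((U × U) × (U × U)) :=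
    { toFun := fun u => ((u, u), (u, u))
      map_add' := fun x y => rfl
      map_smul' := fun c x => rfl }
  have hε' (x) : ε' x = (x.1.1.1 + x.1.1.2 + x.1.2.1 + x.1.2.2,
        A (x.1.1.2 + x.1.2.2) + B (x.1.2.1 + x.1.2.2) + x.2) := rfl
  have hd' (y) : d' y = (((y.1.1 + y.2.1, y.1.1 + y.2.2), (y.1.2 + y.2.1, y.1.2 + y.2.2)),
        A (y.1.1 + y.1.2) + B (y.2.1 + y.2.2)) := rfl
  have hd'' (u) : d'' u = ((u, u), (u, u)) := rfl
  refine ppdim_le_two (ρ₀ := freeTrivialRep k U W) (ρ₁ := cosetRep k U)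
    (ρ₂ := Representation.trivial k KleinV4 U) isPPermutation_freeTrivialRep
    isPPermutation_cosetRep
    (isPPermutation_of_basis (Basis.ofVectorSpace k U) (fun i => ⟨i, by simp⟩)
      (fun i => ⟨i, by simp⟩))
    (intertwiningMapOfGenerators d'' ?_ ?_) (intertwiningMapOfGenerators d' ?_ ?_)
    (intertwiningMapOfGenerators (φ.toLinearMap ∘ₗ ε') ?_ ?_) ?_ ?_ ?_ ?_
  · intro u
    simp [hd'', cosetRep_σ]
  · intro u
    simp [hd'', cosetRep_τ]
  · intro y
    simp [hd', cosetRep_σ, freeTrivialRep_σ, add_comm]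
  · intro y
    simp [hd', cosetRep_τ, freeTrivialRep_τ, add_comm]
  · intro x
    simp only [LinearMap.comp_apply, LinearEquiv.coe_coe, hσ, hε', freeTrivialRep_σ]
    congr 1
    ext
    · simp only; abel
    · simp only [map_add]
      linear_combination (norm := module) -twoW (A x.1.1.2) - twoW (A x.1.2.2)
  · intro x
    simp only [LinearMap.comp_apply, LinearEquiv.coe_coe, hτ, hε', freeTrivialRep_τ]
    congr 1
    ext
    · simp only; abel
    · simp only [map_add]
      linear_combination (norm := module) -twoW (B x.1.2.1) - twoW (B x.1.2.2)
  · intro u u' h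
    exact congrArg (fun y : (U × U) × (U × U) => y.1.1) h
  · rintro ⟨⟨y₀, y₁⟩, ⟨z₀, z₁⟩⟩
    constructor
    · intro h
      have h' : d' ((y₀, y₁), (z₀, z₁)) = 0 := h
      simp only [hd', Prod.mk_eq_zero] at h'
      obtain ⟨⟨⟨h1, h2⟩, ⟨h3, h4⟩⟩, -⟩ := h'
      refine ⟨y₀, ?_⟩
      change ((y₀, y₀), (y₀, y₀)) = ((y₀, y₁), (z₀, z₁))
      have e1 : y₀ = z₀ := by linear_combination (norm := module) h1 - twoU z₀
      have e2 : y₀ = z₁ := by linear_combination (norm := module) h2 - twoU z₁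
      have e3 : y₀ = y₁ := by linear_combination (norm := module) h1 - h3
      rw [← e1, ← e2, ← e3]
    · rintro ⟨u, h⟩
      rw [← h]
      change d' ((u, u), (u, u)) = 0
      simp [hd', twoU]
  · rintro ⟨⟨⟨x₀, x₁⟩, ⟨x₂, x₃⟩⟩, w⟩
    constructor
    · intro h
      have h' : φ (ε' (((x₀, x₁), (x₂, x₃)), w)) = 0 := h
      rw [LinearEquiv.map_eq_zero_iff, hε', Prod.mk_eq_zero] at h'
      obtain ⟨h1, h2⟩ := h'
      simp only at h1 h2
      refine ⟨((x₀, x₂), (0, x₀ + x₁)), ?_⟩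
      change d' ((x₀, x₂), (0, x₀ + x₁)) = _
      have e3 : x₂ + (x₀ + x₁) = x₃ := by linear_combination (norm := module) h1 - twoU x₃
      have hA := congrArg A h1
      have hB := congrArg B h1
      simp only [map_add, map_zero] at hA hB h2
      simp only [hd', Prod.mk.injEq, add_zero, zero_add, map_add, e3, and_true, true_and]
      refine ⟨by linear_combination (norm := module) twoU x₀, ?_⟩
      linear_combination (norm := module) h2 - twoW w + hA - twoW (A x₁) - twoW (A x₃) + hB -
        twoW (B x₂) - twoW (B x₃)
    · rintro ⟨⟨⟨y₀, y₁⟩, ⟨z₀, z₁⟩⟩, h⟩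
      rw [← h]
      change φ (ε' (d' ((y₀, y₁), (z₀, z₁)))) = 0
      rw [LinearEquiv.map_eq_zero_iff]
      simp only [hd', hε', map_add, Prod.mk_eq_zero]
      constructor
      · linear_combination (norm := module) twoU y₀ + twoU y₁ + twoU z₀ + twoU z₁
      · linear_combination (norm := module) twoW (A y₀) + twoW (A y₁) + twoW (A z₁) +
          twoW (B z₀) + twoW (B z₁) + twoW (B y₁)
  · intro z
    obtain ⟨⟨u, w⟩, rfl⟩ := φ.surjective z
    refine ⟨(((u, 0), (0, 0)), w), ?_⟩
    change φ (ε' (((u, 0), (0, 0)), w)) = _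
    simp [hε']

end

theorem ppdim_MRep_le_two (n : ℕ) : ppdim 2 (MRep k n) ≤ 2 := by
  let φ := (Finsupp.sumFinsuppLEquivProdFinsupp k (α := Fin n) (β := Fin (n + 1)) (M := k)).symm
  let A : (Fin n →₀ k) →ₗ[k] (Fin (n + 1) →₀ k) := Finsupp.lmapDomain k k Fin.castSucc
  let B : (Fin n →₀ k) →ₗ[k] (Fin (n + 1) →₀ k) := Finsupp.lmapDomain k k Fin.succ
  have ha : MSpace.a k n ∘ₗ φ.toLinearMap =
      φ.toLinearMap ∘ₗ (0 : _ →ₗ[k] (Fin n →₀ k)).prod (A ∘ₗ LinearMap.fst k _ _) := by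
    ext i j <;> simp [φ, A, MSpace.a]
  have hb : MSpace.b k n ∘ₗ φ.toLinearMap =
      φ.toLinearMap ∘ₗ (0 : _ →ₗ[k] (Fin n →₀ k)).prod (B ∘ₗ LinearMap.fst k _ _) := by
    ext i j <;> simp [φ, B, MSpace.b]
  refine ppdim_le_two_of_radical_sq_eq_zero A B φ (fun z => ?_) (fun z => ?_)
  · have h : MSpace.a k n (φ z) = φ (0, A z.1) := LinearMap.congr_fun ha z
    rw [MRep, kleinRep_σ, LinearMap.add_apply, h, Module.End.one_apply, ← map_add]
    congr 1
    ext1 <;> simp [add_comm]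
  · have h : MSpace.b k n (φ z) = φ (0, B z.1) := LinearMap.congr_fun hb z
    rw [MRep, kleinRep_τ, LinearMap.add_apply, h, Module.End.one_apply, ← map_add]
    congr 1
    ext1 <;> simp [add_comm]

end Resolution

theorem mainTheorem5 {k : Type u} [Field k] [CharP k 2] (n : ℕ) (hn : 4 ≤ n) :
    ppdim 2 (MRep k n) = 2 := by
  refine le_antisymm (ppdim_MRep_le_two n) (le_iInf fun R => ?_)
  -- A resolution of length at most one has an injective first differential.
  by_contra! h
  have hsub (i : ℕ) (hi : 2 ≤ i) : Subsingleton (R.X i) := by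
    by_contra hn
    have h2 : (i : ℕ∞) ≤ R.length := le_iSup₂_of_le i (not_subsingleton_iff_nontrivial.1 hn) le_rfl
    exact absurd (h2.trans_lt h) (not_lt.2 (by exact_mod_cast hi))
  let _ := R.addCommGroup
  let _ := R.module
  have := R.finite
  have hinj : Function.Injective (R.d 0) := by
    refine (injective_iff_map_eq_zero (R.d 0)).2 fun x hx => ?_
    obtain ⟨y, rfl⟩ := (R.exact_d 0 x).1 hx
    have := hsub 2 le_rfl
    rw [Subsingleton.elim y 0, map_zero]
  have := MRep_le_three_of_exact (R.isPPermutation 1) (R.isPPermutation 0) (R.d 0) R.ε hinj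
    R.exact_ε R.surjective_ε
  omega
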